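/- Let $G$ be a finite simple graph with vertex set $V$, $|V| = n$. A permutation of $V$ is a bijection $\sigma : V \to \{1,\dots,n\}$; it separates two disjoint edges $e$ and $f$ of $G$ if either $\sigma(a) < \sigma(b)$ for all $a \in e$, $b \in f$, or $\sigma(b) < \sigma(a)$ for all $a \in e$, $b \in f$. The separation dimension $\pi(G)$ is the smallest cardinality of a (possibly empty) family of permutations of $V$ such that every two disjoint edges of $G$ are separated by at least one member of the family. For a real number $x$ let $\log^{\star} x$ be the iterated logarithm to the base $2$, i.e. the least number of times that $\log_2$ has to be applied, starting from $x$, so that the result is at most $1$ (in particular $\log^{\star} x = 0$ for $x \le 1$). **Theorem.** Every finite simple graph $G$ of maximum degree $\Delta$ satisfies $$\pi(G) \le 2^{9 \log^{\star} \Delta}\, \Delta .$$ -/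

import Mathlib

namespace SepDim

/-- A permutation of the (finite) vertex set of `H`: a bijection from `V(H)` to `{1, …, |V(H)|}`
(represented by `Fin |V(H)|`). -/
abbrev VertexPerm {α : Type*} (H : Hypergraph α) : Type _ :=
  H.vertexSet ≃ Fin (Nat.card H.vertexSet)

/-- Every vertex of `A` comes before every vertex of `B` in `σ`. -/
def Precedes {α : Type*} {H : Hypergraph α} (σ : VertexPerm H) (A B : Set α) : Prop :=
  ∀ a b : H.vertexSet, (a : α) ∈ A → (b : α) ∈ B → σ a < σ b

/-- `σ` separates `A` and `B`: all of one of the two sets comes before all of the other. -/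
def Separates {α : Type*} {H : Hypergraph α} (σ : VertexPerm H) (A B : Set α) : Prop :=
  Precedes σ A B ∨ Precedes σ B A

/-- A family `F` of permutations of the vertices is pairwise suitable for `H` if any two disjoint
edges of `H` are separated by some member of `F`. -/
def PairwiseSuitable {α : Type*} (H : Hypergraph α) (F : Finset (VertexPerm H)) : Prop :=
  ∀ e ∈ H.edgeSet, ∀ f ∈ H.edgeSet, Disjoint e f → ∃ σ ∈ F, Separates σ e f

/-- The separation dimension `π(H)` of a finite hypergraph `H`: the cardinality of a smallest
family of permutations which is pairwise suitable for `H`. The empty family is allowed, so that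
`π(H) = 0` if `H` has no two disjoint edges. -/
noncomputable def separationDimension {α : Type*} (H : Hypergraph α) : ℕ :=
  sInf {k : ℕ | ∃ F : Finset (VertexPerm H), F.card = k ∧ PairwiseSuitable H F}

/-- A finite hypergraph has a pairwise suitable family, so the infimum that defines
`separationDimension` is attained. -/
theorem exists_pairwiseSuitable {α : Type*} (H : Hypergraph α) [Finite H.vertexSet] :
    ∃ F : Finset (VertexPerm H),
      F.card = separationDimension H ∧ PairwiseSuitable H F := by
  classical
  have := Fintype.ofFinite H.vertexSet
  have hne : {k : ℕ | ∃ F : Finset (VertexPerm H),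
      F.card = k ∧ PairwiseSuitable H F}.Nonempty := by
    refine ⟨_, Finset.univ, rfl, ?_⟩
    intro e _ f _ hef
    -- order the vertices so that those of `e` come first
    let τ : VertexPerm H := Finite.equivFin H.vertexSet
    let g : H.vertexSet → ℕ ×ₗ Fin (Nat.card H.vertexSet) :=
      fun v => toLex (if (v : α) ∈ e then 0 else 1, τ v)
    have hg : Function.Injective g := by
      intro a b hab
      have h2 : (ofLex (g a)).2 = (ofLex (g b)).2 := by rw [hab]
      exact τ.injective h2
    let _ : LinearOrder H.vertexSet := LinearOrder.lift' g hg
    let σ : H.vertexSet ≃o Fin (Nat.card H.vertexSet) :=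
      (Fintype.orderIsoFinOfCardEq H.vertexSet (Nat.card_eq_fintype_card).symm).symm
    refine ⟨σ.toEquiv, Finset.mem_univ _, Or.inl ?_⟩
    intro a b ha hb
    have hb' : (b : α) ∉ e := fun h => Set.disjoint_left.mp hef h hb
    have hlt : a < b := by
      change g a < g b
      rw [Prod.Lex.lt_iff]
      left
      change (if (a : α) ∈ e then 0 else 1) < (if (b : α) ∈ e then 0 else 1)
      simp [ha, hb']
    exact σ.lt_iff_lt.mpr hlt
  exact Nat.sInf_mem hne

/-- A simple graph, viewed as a (2-uniform) hypergraph on the same vertices: the edges are the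
sets `{u, v}` with `u` and `v` adjacent. -/
def graphHypergraph {V : Type*} (G : SimpleGraph V) : Hypergraph V where
  vertexSet := Set.univ
  edgeSet := {e | ∃ u v : V, G.Adj u v ∧ e = {u, v}}
  subset_vertexSet_of_mem_edgeSet' := fun _ _ => Set.subset_univ _

/-- The iterated logarithm to the base 2: the least number of times that `log₂` has to be applied,
starting at `x`, so that the result is at most `1`. -/
noncomputable def logStar (x : ℝ) : ℕ :=
  sInf {k : ℕ | (Real.logb 2)^[k] x ≤ 1}

/-- Iterating `log₂` does reach a value that is at most `1`, so the infimum that defines `logStar`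
is attained. -/
theorem iterate_logStar_le_one (x : ℝ) : (Real.logb 2)^[logStar x] x ≤ 1 := by
  have key : ∀ n : ℕ, ∀ y : ℝ, y ≤ n → ∃ k : ℕ, (Real.logb 2)^[k] y ≤ 1 := by
    intro n
    induction n with
    | zero => exact fun y hy => ⟨0, by simp at hy ⊢; linarith⟩
    | succ n ih =>
      intro y hy
      by_cases h1 : y ≤ 1
      · exact ⟨0, by simpa using h1⟩
      · have hpow : ((n + 1 : ℕ) : ℝ) ≤ (2 : ℝ) ^ n := by
          exact_mod_cast Nat.lt_two_pow_self
        have hlog : Real.logb 2 y ≤ n := by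
          rw [Real.logb_le_iff_le_rpow (by norm_num) (by linarith)]
          rw [Real.rpow_natCast]
          exact hy.trans hpow
        obtain ⟨k, hk⟩ := ih _ hlog
        exact ⟨k + 1, by simpa [Function.iterate_succ_apply] using hk⟩
  obtain ⟨n, hn⟩ := exists_nat_ge x
  have hne : {k : ℕ | (Real.logb 2)^[k] x ≤ 1}.Nonempty := key n x hn
  exact Nat.sInf_mem hne

end SepDim

section

open Finset
open scoped Classical

/-! Colour the vertices with `r` colours, `r` about `96 * Δ / d` and `2 * d` about `log₂ Δ`, so that
no vertex has more than `d` neighbours of one colour (`exists_frugal_colouring`). For each `s` in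
`ZMod r`, the edges inside the blocks `{i, s - i}` form a graph of maximum degree at most `2 * d`,
and any two colours share a block for `s = i + j`. So disjoint edges using at most two colours are
separated by `r` recursive families, one for each `s`, and `r * (2 * d) ≤ 194 * Δ`. Disjoint edges
using three or four colours need only polylogarithmically many further rankings
(`rankSeparable_of_colouring`, `exists_separating_hash`). Each passage from `Δ` to `2 * d` lowers
`logStar` by at least one and costs a factor of at most `2 ^ 9`. -/

/-- Some family of at most `k` (not necessarily injective) rankings of the vertices separates
every two disjoint edges of `G`. -/
def SimpleGraph.RankSeparable {V : Type*} (G : SimpleGraph V) (k : ℕ) : Prop :=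
  ∃ F : Finset (V → ℕ), #F ≤ k ∧ ∀ a b c d, G.Adj a b → G.Adj c d →
    a ≠ c → a ≠ d → b ≠ c → b ≠ d →
    ∃ f ∈ F, (f a < f c ∧ f a < f d ∧ f b < f c ∧ f b < f d) ∨
      (f c < f a ∧ f d < f a ∧ f c < f b ∧ f d < f b)

/-! ### From rankings to permutations. -/

namespace SimpleGraph

variable {V : Type*} {G : SimpleGraph V}

theorem RankSeparable.mono {k l : ℕ} (h : G.RankSeparable k) (hkl : k ≤ l) :
    G.RankSeparable l := by
  obtain ⟨F, hF, h⟩ := h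
  exact ⟨F, hF.trans hkl, h⟩

/-- Every ranking is refined by a permutation. -/
theorem exists_vertexPerm_refining [Finite V] (G : SimpleGraph V) (f : V → ℕ) :
    ∃ σ : SepDim.VertexPerm (SepDim.graphHypergraph G), ∀ u v, f u < f v →
      σ ⟨u, Set.mem_univ u⟩ < σ ⟨v, Set.mem_univ v⟩ := by
  have : Finite (SepDim.graphHypergraph G).vertexSet :=
    inferInstanceAs (Finite (Set.univ : Set V))
  have := Fintype.ofFinite (SepDim.graphHypergraph G).vertexSet
  let τ : SepDim.VertexPerm (SepDim.graphHypergraph G) := Finite.equivFin _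
  let g : (SepDim.graphHypergraph G).vertexSet →
      ℕ ×ₗ Fin (Nat.card (SepDim.graphHypergraph G).vertexSet) :=
    fun v => toLex (f v, τ v)
  have hg : Function.Injective g := fun a b hab => τ.injective (by
    have h2 : (ofLex (g a)).2 = (ofLex (g b)).2 := by rw [hab]
    exact h2)
  let _ : LinearOrder (SepDim.graphHypergraph G).vertexSet := LinearOrder.lift' g hg
  let σ : (SepDim.graphHypergraph G).vertexSet ≃o
      Fin (Nat.card (SepDim.graphHypergraph G).vertexSet) :=
    (Fintype.orderIsoFinOfCardEq _ (Nat.card_eq_fintype_card).symm).symm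
  refine ⟨σ.toEquiv, fun u v huv => σ.lt_iff_lt.mpr ?_⟩
  change g ⟨u, Set.mem_univ u⟩ < g ⟨v, Set.mem_univ v⟩
  rw [Prod.Lex.lt_iff]
  exact Or.inl huv

theorem RankSeparable.separationDimension_le [Finite V] {k : ℕ} (h : G.RankSeparable k) :
    SepDim.separationDimension (SepDim.graphHypergraph G) ≤ k := by
  obtain ⟨F, hF, hsep⟩ := h
  choose σ hσ using exists_vertexPerm_refining G
  suffices h : SepDim.PairwiseSuitable (SepDim.graphHypergraph G) (F.image σ) by
    refine le_trans ?_ (card_image_le.trans hF : #(F.image σ) ≤ k)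
    unfold SepDim.separationDimension
    exact Nat.sInf_le ⟨_, rfl, h⟩
  rintro _ ⟨a, b, hab, rfl⟩ _ ⟨c, d, hcd, rfl⟩ hdisj
  simp only [Set.disjoint_insert_left, Set.disjoint_singleton_left, Set.mem_insert_iff,
    Set.mem_singleton_iff, not_or] at hdisj
  obtain ⟨f, hf, h⟩ := hsep a b c d hab hcd hdisj.1.1 hdisj.1.2 hdisj.2.1 hdisj.2.2
  refine ⟨σ f, mem_image_of_mem σ hf, ?_⟩
  rcases h with ⟨h1, h2, h3, h4⟩ | ⟨h1, h2, h3, h4⟩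
  · left
    rintro ⟨x, hx⟩ ⟨y, hy⟩ (rfl | rfl) (rfl | rfl) <;> exact hσ _ _ _ (by assumption)
  · right
    rintro ⟨x, hx⟩ ⟨y, hy⟩ (rfl | rfl) (rfl | rfl) <;> exact hσ _ _ _ (by assumption)

/-! ### Reduction to block graphs by a colouring. -/

/-- The edges of `G` whose ends lie in the same block, when the colours are grouped into the
blocks `{i, s - i}`. -/
def blockSubgraph {C : Type*} [AddCommGroup C] (G : SimpleGraph V) (c : V → C) (s : C) :
    SimpleGraph V where
  Adj u v := G.Adj u v ∧ (c u = c v ∨ c u + c v = s)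
  symm := ⟨fun u v h => ⟨h.1.symm, h.2.imp Eq.symm fun h' => by rw [add_comm, h']⟩⟩
  loopless := ⟨fun u h => G.loopless.irrefl u h.1⟩

/-- The first summand serves pairs of edges on at most two colours. For the others, a hash keeps the
relevant colours apart, and a ranking is fixed by a hash, two hash values and a direction. -/
theorem rankSeparable_of_colouring [Fintype V] {C X : Type*} [AddCommGroup C] [Fintype C]
    [Fintype X] (c : V → C) {k : ℕ} (hk : ∀ s, (G.blockSubgraph c s).RankSeparable k)
    (H : Finset (C → X)) (hH : ∀ i j l m : C, ∃ h ∈ H,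
      (i ≠ l → h i ≠ h l) ∧ (i ≠ m → h i ≠ h m) ∧ (j ≠ l → h j ≠ h l) ∧ (j ≠ m → h j ≠ h m)) :
    G.RankSeparable (Fintype.card C * k + #H * (Fintype.card X ^ 2 * 2)) := by
  choose F hF hFsep using hk
  set K := Fintype.card V
  obtain ⟨w, hwK, hw⟩ : ∃ w : V → ℕ, (∀ v, w v < K) ∧ w.Injective :=
    ⟨fun v => Fintype.equivFin V v, fun v => (Fintype.equivFin V v).2, fun a b hab =>
      (Fintype.equivFin V).injective (Fin.ext hab)⟩
  -- Three levels: value `x` at the bottom, `y` in the middle, all else on top. Within a level, `w`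
  -- or its reverse decides.
  let g : X → X → X → ℕ := fun x y z => if z = x then 0 else if z = y then 1 else 2
  let w' : Bool → V → ℕ := fun t v => if t then w v else K - 1 - w v
  let Φ : (C → X) × X × X × Bool → V → ℕ := fun p v =>
    K * g p.2.1 p.2.2.1 (p.1 (c v)) + w' p.2.2.2 v
  have hw'K : ∀ t v, w' t v < K := fun t v => by
    have := hwK v
    simp only [w']; split_ifs <;> omega
  have hlt : ∀ p u v, g p.2.1 p.2.2.1 (p.1 (c u)) < g p.2.1 p.2.2.1 (p.1 (c v)) →
      Φ p u < Φ p v := fun p u v h => by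
    have h1 := hw'K p.2.2.2 u
    have h2 := Nat.mul_le_mul_left K (Nat.succ_le_of_lt h)
    rw [Nat.mul_succ] at h2
    simp only [Φ]; omega
  have hflip : ∀ u v, u ≠ v → ∃ t, w' t u < w' t v := fun u v huv => by
    rcases lt_or_gt_of_ne (hw.ne huv) with h | h
    · exact ⟨true, by simpa [w'] using h⟩
    · refine ⟨false, ?_⟩
      have := hwK u
      simp only [w', Bool.false_eq_true, if_false]; omega
  let P : Finset (V → ℕ) := (H ×ˢ (univ : Finset (X × X × Bool))).image Φ
  have hP : ∀ h ∈ H, ∀ x y t, Φ (h, x, y, t) ∈ P := fun h hh x y t =>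
    mem_image_of_mem _ (by simpa using hh)
  -- two edges with vertices of the same colour, on three colours in total
  have share : ∀ a b e d, a ≠ e → c a = c e → c b ≠ c a → c d ≠ c a → c b ≠ c d →
      ∃ f ∈ P, f a < f e ∧ f a < f d ∧ f b < f e ∧ f b < f d := by
    intro a b e d hae hace hba hda hbd
    obtain ⟨h, hh, h1, h2, -, h3⟩ := hH (c b) (c d) (c d) (c a)
    obtain ⟨t, ht⟩ := hflip a e hae
    have hbd' := h1 hbd
    have hba' := h2 hba
    have hda' := h3 hda
    -- `b` is at the bottom, `a` and `e` share the middle level, where `t` puts `a` first, and `d`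
    -- is on top.
    refine ⟨Φ (h, h (c b), h (c a), t), hP h hh _ _ _, ?_, hlt _ _ _ ?_, hlt _ _ _ ?_,
      hlt _ _ _ ?_⟩
    · simp only [Φ, hace]; omega
    all_goals simp [g, ← hace, hbd'.symm, hba'.symm, hda']
  refine ⟨univ.biUnion F ∪ P, ?_, ?_⟩
  · refine (card_union_le _ _).trans (Nat.add_le_add ?_ ?_)
    · exact card_biUnion_le_card_mul _ _ _ fun s _ => hF s
    · refine card_image_le.trans (le_of_eq ?_)
      simp [card_product, sq, mul_assoc]
  intro a b e d hab hed hae had hbe hbd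
  by_cases hA : ∃ i j, (c a = i ∨ c a = j) ∧ (c b = i ∨ c b = j) ∧ (c e = i ∨ c e = j) ∧
      (c d = i ∨ c d = j)
  · obtain ⟨i, j, h1, h2, h3, h4⟩ := hA
    have key : ∀ u v, G.Adj u v → (c u = i ∨ c u = j) → (c v = i ∨ c v = j) →
        (G.blockSubgraph c (i + j)).Adj u v := by
      rintro u v huv (h | h) (h' | h') <;> refine ⟨huv, ?_⟩ <;> simp [h, h', add_comm]
    obtain ⟨f, hf, h⟩ := hFsep (i + j) a b e d (key a b hab h1 h2) (key e d hed h3 h4)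
      hae had hbe hbd
    exact ⟨f, mem_union_left _ (mem_biUnion.2 ⟨_, mem_univ _, hf⟩), h⟩
  suffices ∃ f ∈ P, (f a < f e ∧ f a < f d ∧ f b < f e ∧ f b < f d) ∨
      (f e < f a ∧ f d < f a ∧ f e < f b ∧ f d < f b) by
    obtain ⟨f, hf, h⟩ := this
    exact ⟨f, mem_union_right _ hf, h⟩
  by_cases h1 : c a = c e
  · obtain ⟨f, hf, h⟩ := share a b e d hae h1 (fun h => hA ⟨c a, c d, by grind⟩)
      (fun h => hA ⟨c a, c b, by grind⟩) (fun h => hA ⟨c a, c b, by grind⟩)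
    exact ⟨f, hf, by tauto⟩
  by_cases h2 : c a = c d
  · obtain ⟨f, hf, h⟩ := share a b d e had h2 (fun h => hA ⟨c a, c e, by grind⟩)
      (fun h => hA ⟨c a, c b, by grind⟩) (fun h => hA ⟨c a, c b, by grind⟩)
    exact ⟨f, hf, by tauto⟩
  by_cases h3 : c b = c e
  · obtain ⟨f, hf, h⟩ := share b a e d hbe h3 (fun h => hA ⟨c b, c d, by grind⟩)
      (fun h => hA ⟨c b, c a, by grind⟩) (fun h => hA ⟨c b, c a, by grind⟩)
    exact ⟨f, hf, by tauto⟩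
  by_cases h4 : c b = c d
  · obtain ⟨f, hf, h⟩ := share b a d e hbd h4 (fun h => hA ⟨c b, c e, by grind⟩)
      (fun h => hA ⟨c b, c a, by grind⟩) (fun h => hA ⟨c b, c a, by grind⟩)
    exact ⟨f, hf, by tauto⟩
  -- No colour is common to the two edges: `a` and `b` fill the lower levels, `e` and `d` lie on
  -- top.
  obtain ⟨h, hh, k1, k2, k3, k4⟩ := hH (c a) (c b) (c e) (c d)
  refine ⟨Φ (h, h (c a), h (c b), true), hP h hh _ _ _, Or.inl ⟨hlt _ _ _ ?_, hlt _ _ _ ?_,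
    hlt _ _ _ ?_, hlt _ _ _ ?_⟩⟩ <;>
  · simp only [g, (k1 h1).symm, (k2 h2).symm, (k3 h3).symm, (k4 h4).symm, if_false]
    split_ifs <;> omega

/-- Distinct residues below `2 ^ t` differ in one of `t` binary digits. Four pairs must be told
apart, so recording four digits suffices, with only 16 hash values. -/
theorem exists_separating_hash {r t : ℕ} [NeZero r] (ht : 0 < t) (hrt : r ≤ 2 ^ t) :
    ∃ H : Finset (ZMod r → Fin 4 → Bool), #H ≤ t ^ 4 ∧ ∀ i j l m, ∃ h ∈ H,
      (i ≠ l → h i ≠ h l) ∧ (i ≠ m → h i ≠ h m) ∧ (j ≠ l → h j ≠ h l) ∧ (j ≠ m → h j ≠ h m) := by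
  refine ⟨univ.image fun (p : Fin 4 → Fin t) z q => z.val.testBit (p q), ?_, ?_⟩
  · exact card_image_le.trans (by simp)
  intro i j l m
  have key : ∀ x y : ZMod r, ∃ q : Fin t, x ≠ y → x.val.testBit q ≠ y.val.testBit q := by
    intro x y
    by_contra! hq
    refine (hq ⟨0, ht⟩).1 (ZMod.val_injective r (Nat.eq_of_testBit_eq fun q => ?_))
    by_cases hqt : q < t
    · exact (hq ⟨q, hqt⟩).2
    · have hpow : 2 ^ t ≤ 2 ^ q := Nat.pow_le_pow_right (by norm_num) (not_lt.1 hqt)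
      rw [Nat.testBit_lt_two_pow ((ZMod.val_lt x).trans_le (hrt.trans hpow)),
        Nat.testBit_lt_two_pow ((ZMod.val_lt y).trans_le (hrt.trans hpow))]
  obtain ⟨q₁, h₁⟩ := key i l
  obtain ⟨q₂, h₂⟩ := key i m
  obtain ⟨q₃, h₃⟩ := key j l
  obtain ⟨q₄, h₄⟩ := key j m
  refine ⟨_, mem_image_of_mem _ (mem_univ ![q₁, q₂, q₃, q₄]), fun h e => h₁ h ?_,
    fun h e => h₂ h ?_, fun h e => h₃ h ?_, fun h e => h₄ h ?_⟩
  · simpa using congrFun e 0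
  · simpa using congrFun e 1
  · simpa using congrFun e 2
  · simpa using congrFun e 3

/-! ### Proper colourings and small maximum degree. -/

/-- A graph has a proper colouring with more colours than its maximum degree. -/
theorem exists_proper_colouring [Fintype V] {C : Type*} [Fintype C] (H : SimpleGraph V)
    (hdeg : ∀ v, #{u | H.Adj v u} < Fintype.card C) :
    ∃ c : V → C, ∀ u v, H.Adj u v → c u ≠ c v := by
  suffices ∀ S : Finset V, ∃ c : V → C, ∀ u ∈ S, ∀ v ∈ S, H.Adj u v → c u ≠ c v by
    simpa using this univ
  intro S
  induction S using Finset.induction_on with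
  | empty =>
    rcases isEmpty_or_nonempty V with hV | ⟨⟨v⟩⟩
    · exact ⟨fun v => hV.elim v, by simp⟩
    · have : Nonempty C := Fintype.card_pos_iff.1 (Nat.zero_lt_of_lt (hdeg v))
      exact ⟨fun _ => Classical.arbitrary C, by simp⟩
  | insert v S hv ih =>
    obtain ⟨c, hc⟩ := ih
    obtain ⟨x, hx⟩ : ∃ x, x ∉ image c {u | H.Adj v u} := by
      by_contra! h
      have := card_image_le (s := ({u | H.Adj v u} : Finset V)) (f := c)
      rw [eq_univ_of_forall h, card_univ] at this
      exact (hdeg v).not_ge this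
    simp only [mem_image, mem_filter, mem_univ, true_and, not_exists, not_and] at hx
    refine ⟨Function.update c v x, fun a ha b hb hab => ?_⟩
    have := H.ne_of_adj hab
    rcases eq_or_ne a v with rfl | hav <;> rcases eq_or_ne b a with rfl | hba
    · exact absurd rfl this
    · simpa [Function.update_of_ne hba, eq_comm] using hx b hab
    · exact absurd rfl this
    · rcases eq_or_ne b v with rfl | hbv
      · simpa [Function.update_of_ne hav] using hx a hab.symm
      · simpa [Function.update_of_ne hav, Function.update_of_ne hbv] using
          hc a (mem_of_mem_insert_of_ne ha hav) b (mem_of_mem_insert_of_ne hb hbv) hab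

theorem rankSeparable_zero [Fintype V] (h : ∀ v, #{u | G.Adj v u} = 0) : G.RankSeparable 0 :=
  ⟨∅, by simp, fun a b _ _ hab => by
    have := h a
    rw [card_eq_zero, filter_eq_empty_iff] at this
    exact absurd hab (this (mem_univ b))⟩

/-- The edges form a matching. Ranking a vertex by its closed neighbourhood gives the ends of an
edge one rank and different edges different ranks. -/
theorem rankSeparable_one [Fintype V] (h : ∀ v, #{u | G.Adj v u} ≤ 1) : G.RankSeparable 1 := by
  have key : ∀ u v, G.Adj u v → insert u ({x | G.Adj u x} : Finset V) = {u, v} := by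
    intro u v huv
    congr 1
    refine (card_eq_one.1 ((h u).antisymm (card_pos.2 ⟨v, by simpa⟩))).elim fun x hx => ?_
    have : v ∈ ({x} : Finset V) := by rw [← hx]; simpa
    rw [hx, mem_singleton.1 this]
  let f : V → ℕ := fun u => Fintype.equivFin (Finset V) (insert u ({x | G.Adj u x} : Finset V))
  refine ⟨{f}, by simp, fun a b c d hab hcd hac had hbc hbd => ⟨f, by simp, ?_⟩⟩
  have hb : f b = f a := by
    simp only [f, key a b hab, key b a hab.symm, pair_comm]
  have hd : f d = f c := by
    simp only [f, key c d hcd, key d c hcd.symm, pair_comm]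
  have hne : f a ≠ f c := by
    intro e
    have := (Fintype.equivFin (Finset V)).injective (Fin.ext e)
    rw [key a b hab, key c d hcd] at this
    have ha : a ∈ ({c, d} : Finset V) := by rw [← this]; simp
    simp [hac, had] at ha
  omega

/-- The crude polynomial bound that serves graphs of small maximum degree. -/
theorem rankSeparable_of_sq_colouring [Fintype V] {Δ : ℕ} (h : ∀ v, #{u | G.Adj v u} ≤ Δ) :
    G.RankSeparable ((Δ ^ 2 + 1) + (Δ ^ 2 + 1) ^ 2 * 2) := by
  -- In a proper colouring of the square of `G`, the neighbours of a vertex have distinct colours,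
  -- so every block graph is a matching.
  let H : SimpleGraph V :=
    { Adj := fun u v => u ≠ v ∧ (G.Adj u v ∨ ∃ x, G.Adj u x ∧ G.Adj x v)
      symm := ⟨fun u v h => ⟨h.1.symm, h.2.imp (fun h => h.symm)
        fun ⟨x, h1, h2⟩ => ⟨x, h2.symm, h1.symm⟩⟩⟩
      loopless := ⟨fun u h => h.1 rfl⟩ }
  have hH : ∀ v, #{u | H.Adj v u} ≤ Δ ^ 2 := by
    intro v
    have hsub : ({u | H.Adj v u} : Finset V) ⊆
        ({x | G.Adj v x} : Finset V).biUnion fun x =>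
          insert x (({u | G.Adj x u} : Finset V).erase v) := by
      intro u hu
      obtain ⟨hne, h1 | ⟨x, h1, h2⟩⟩ : H.Adj v u := by simpa using hu
      · exact mem_biUnion.2 ⟨u, by simpa using h1, mem_insert_self _ _⟩
      · exact mem_biUnion.2 ⟨x, by simpa using h1, by simp [hne.symm, h2]⟩
    refine (card_le_card hsub).trans ((card_biUnion_le_card_mul _ _ Δ fun x hx => ?_).trans ?_)
    · have hx' : G.Adj v x := by simpa using hx
      have hvx : v ∈ ({u | G.Adj x u} : Finset V) := by simpa using hx'.symm
      have h1 := card_insert_le x (({u | G.Adj x u} : Finset V).erase v)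
      have h2 := card_erase_add_one hvx
      have h3 := h x
      omega
    · rw [sq]; exact Nat.mul_le_mul_right _ (h v)
  obtain ⟨c, hc⟩ := exists_proper_colouring (C := ZMod (Δ ^ 2 + 1)) H fun v => by
    rw [ZMod.card]; exact Nat.lt_succ_of_le (by convert hH v)
  have := rankSeparable_of_colouring (G := G) c (k := 1) (fun s => rankSeparable_one fun v => ?_)
    {id} fun i j l m => ⟨id, by simp⟩
  · simpa [ZMod.card] using this
  refine card_le_one.2 fun x hx y hy => ?_
  obtain ⟨hx1, hx2⟩ : (G.blockSubgraph c s).Adj v x := by simpa using hx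
  obtain ⟨hy1, hy2⟩ : (G.blockSubgraph c s).Adj v y := by simpa using hy
  have hx3 := hx2.resolve_left (hc v x ⟨G.ne_of_adj hx1, Or.inl hx1⟩)
  have hy3 := hy2.resolve_left (hc v y ⟨G.ne_of_adj hy1, Or.inl hy1⟩)
  by_contra hne
  exact hc x y ⟨hne, Or.inr ⟨v, hx1.symm, hy1⟩⟩ (add_left_cancel (hx3.trans hy3.symm))

end SimpleGraph

/-! ### Frugal colourings by counting. -/

/-- The colourings in which no vertex has more than `d` neighbours of one colour in `S`. -/
noncomputable def SimpleGraph.frugalColourings {V : Type*} [Fintype V] (G : SimpleGraph V)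
    (C : Type*) [Fintype C] (d : ℕ) (S : Finset V) : Finset (V → C) :=
  {c | ∀ v i, #{u ∈ S | G.Adj v u ∧ c u = i} ≤ d}

namespace SimpleGraph

variable {V : Type*} [Fintype V] {G : SimpleGraph V} {C : Type*} [Fintype C] {d : ℕ}

theorem mem_frugalColourings {S : Finset V} {c : V → C} :
    c ∈ G.frugalColourings C d S ↔ ∀ v i, #{u ∈ S | G.Adj v u ∧ c u = i} ≤ d := by
  simp [frugalColourings]

theorem frugalColourings_anti {S T : Finset V} (h : S ⊆ T) :
    G.frugalColourings C d T ⊆ G.frugalColourings C d S := fun _ hc =>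
  mem_frugalColourings.2 fun v i =>
    (card_le_card (filter_subset_filter _ h)).trans (mem_frugalColourings.1 hc v i)

/-- Once the colours outside `T` are chosen, only one in `|C| ^ |T|` colourings gives all of `T`
the colour of `u`. -/
theorem pow_mul_card_frugalColourings_le {S T : Finset V} {u : V} (hu : u ∉ T)
    (hST : Disjoint S T) :
    Fintype.card C ^ #T * #{c ∈ G.frugalColourings C d S | ∀ t ∈ T, c t = c u} ≤
      #(G.frugalColourings C d S) := by
  have : Fintype.card C ^ #T = #(univ : Finset (T → C)) := by simp
  rw [this, ← card_product]
  -- Recolouring `T` at will does not affect frugality on `S`. The old colouring can be recovered,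
  -- since `T` had the colour of `u`, which lies outside `T`.
  refine card_le_card_of_injOn
    (fun p v => if h : v ∈ T then p.1 ⟨v, h⟩ else p.2 v) ?_ ?_
  · rintro ⟨p, c⟩ hp
    have hp' : c ∈ G.frugalColourings C d S := by
      simp only [coe_product, coe_univ, Set.mem_prod, Set.mem_univ, true_and, mem_coe,
        mem_filter] at hp
      exact hp.1
    refine mem_coe.2 (mem_frugalColourings.2 fun v i => ?_)
    convert mem_frugalColourings.1 hp' v i using 2
    refine filter_congr fun x hx => ?_
    simp [Finset.disjoint_left.1 hST hx]
  · rintro ⟨p, c⟩ hp ⟨q, e⟩ hq heq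
    simp only [coe_product, coe_univ, Set.mem_prod, Set.mem_univ, true_and, mem_coe,
      mem_filter] at hp hq
    have hout : ∀ v ∉ T, c v = e v := fun v hv => by
      simpa [hv] using congrFun heq v
    refine Prod.ext (funext fun t => ?_) (funext fun v => ?_)
    · simpa [t.2] using congrFun heq t
    · by_cases hv : v ∈ T
      · change c v = e v
        rw [hp.2 v hv, hq.2 v hv, hout u hu]
      · exact hout v hv

variable {Δ : ℕ}

/-- The vertices of `T` are put back one at a time, each losing at most a factor of two. -/
theorem card_frugalColourings_le_two_pow_mul {S T : Finset V} (hTS : T ⊆ S)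
    (h : ∀ S' ⊂ S, ∀ u ∉ S',
      #(G.frugalColourings C d S') ≤ 2 * #(G.frugalColourings C d (insert u S'))) :
    #(G.frugalColourings C d (S \ T)) ≤ 2 ^ #T * #(G.frugalColourings C d S) := by
  induction T using Finset.induction_on with
  | empty => simp
  | insert t T ht ih =>
    have htS : t ∈ S := hTS (mem_insert_self _ _)
    have h1 := h (S \ insert t T) (Finset.ssubset_iff_subset_ne.2 ⟨sdiff_subset, fun e => by
      rw [← e] at htS; simp at htS⟩) t (by simp)
    have h2 : insert t (S \ insert t T) = S \ T := by
      ext x; simp only [mem_insert, mem_sdiff]; grind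
    rw [h2] at h1
    have h3 := ih ((subset_insert _ _).trans hTS)
    rw [card_insert_of_notMem ht, pow_succ]
    linarith

/-- Rosenfeld's counting argument: adding a vertex destroys at most half of the colourings. -/
theorem card_frugalColourings_le_two_mul (hdeg : ∀ v, #{u | G.Adj v u} ≤ Δ)
    (hr : 2 * (Δ * Δ.choose d) * 2 ^ d ≤ Fintype.card C ^ d) (hC : 0 < Fintype.card C)
    (S : Finset V) : ∀ u ∉ S,
      #(G.frugalColourings C d S) ≤ 2 * #(G.frugalColourings C d (insert u S)) := by
  induction S using Finset.strongInduction with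
  | H S ih =>
  intro u hu
  -- Adding `u` fails only if some neighbour `v` of `u` already has `d` neighbours in `S` of the
  -- colour of `u`; these form `T`. Frugality is asked only off `T`, so that `T` can be recoloured
  -- freely.
  let bad : Finset V → Finset (V → C) := fun T =>
    {c ∈ G.frugalColourings C d (S \ T) | ∀ t ∈ T, c t = c u}
  let W : Finset (Finset V) := ({v | G.Adj u v} : Finset V).biUnion fun v =>
    powersetCard d {x ∈ S | G.Adj v x}
  have hW : #W ≤ Δ * Δ.choose d := by
    refine (card_biUnion_le_card_mul _ _ (Δ.choose d) fun v _ => ?_).trans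
      (Nat.mul_le_mul_right _ (hdeg u))
    rw [card_powersetCard]
    exact Nat.choose_le_choose _
      ((card_le_card (filter_subset_filter _ (subset_univ S))).trans (hdeg v))
  have hcover : G.frugalColourings C d S ⊆ G.frugalColourings C d (insert u S) ∪ W.biUnion bad := by
    intro c hc
    rw [mem_union]
    by_contra! hcon
    refine hcon.1 (mem_frugalColourings.2 fun v i => ?_)
    have hvi := mem_frugalColourings.1 hc v i
    rw [filter_insert]
    split_ifs with huv
    · rw [card_insert_of_notMem (by simp [hu])]
      refine Nat.succ_le_of_lt (lt_of_le_of_ne hvi fun hd => hcon.2 ?_)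
      refine mem_biUnion.2 ⟨{x ∈ S | G.Adj v x ∧ c x = i}, mem_biUnion.2 ⟨v, ?_, ?_⟩, ?_⟩
      · simpa using huv.1.symm
      · refine mem_powersetCard.2 ⟨fun x hx => ?_, hd⟩
        simp only [mem_filter] at hx ⊢
        exact ⟨hx.1, hx.2.1⟩
      · refine mem_filter.2 ⟨frugalColourings_anti sdiff_subset hc, fun t ht => ?_⟩
        rw [(mem_filter.1 ht).2.2, huv.2]
    · exact hvi
  have hbad : ∀ T ∈ W, Fintype.card C ^ d * #(bad T) ≤ 2 ^ d * #(G.frugalColourings C d S) := by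
    intro T hT
    obtain ⟨v, -, hT⟩ := mem_biUnion.1 hT
    obtain ⟨hTS, rfl⟩ := mem_powersetCard.1 hT
    have hTS' : T ⊆ S := hTS.trans (filter_subset _ _)
    exact (pow_mul_card_frugalColourings_le (fun h => hu (hTS' h)) sdiff_disjoint).trans
      (card_frugalColourings_le_two_pow_mul hTS' ih)
  have h1 : Fintype.card C ^ d * #(W.biUnion bad) ≤
      Δ * Δ.choose d * (2 ^ d * #(G.frugalColourings C d S)) := by
    calc _ ≤ Fintype.card C ^ d * ∑ T ∈ W, #(bad T) := Nat.mul_le_mul_left _ card_biUnion_le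
      _ = ∑ T ∈ W, Fintype.card C ^ d * #(bad T) := mul_sum _ _ _
      _ ≤ #W * (2 ^ d * #(G.frugalColourings C d S)) := by
        simpa using sum_le_card_nsmul _ _ _ hbad
      _ ≤ _ := Nat.mul_le_mul_right _ hW
  have h2 : 2 * #(W.biUnion bad) ≤ #(G.frugalColourings C d S) := by
    refine Nat.le_of_mul_le_mul_left ?_ (Nat.pow_pos hC (n := d))
    calc _ = 2 * (Fintype.card C ^ d * #(W.biUnion bad)) := by ring
      _ ≤ 2 * (Δ * Δ.choose d * (2 ^ d * #(G.frugalColourings C d S))) := by gcongr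
      _ = 2 * (Δ * Δ.choose d) * 2 ^ d * #(G.frugalColourings C d S) := by ring
      _ ≤ _ := Nat.mul_le_mul_right _ hr
  have h3 := (card_le_card hcover).trans (card_union_le _ _)
  omega

theorem exists_frugal_colouring (hdeg : ∀ v, #{u | G.Adj v u} ≤ Δ)
    (hr : 2 * (Δ * Δ.choose d) * 2 ^ d ≤ Fintype.card C ^ d) (hC : 0 < Fintype.card C) :
    ∃ c : V → C, ∀ v i, #{u | G.Adj v u ∧ c u = i} ≤ d := by
  suffices ∀ S : Finset V, 0 < #(G.frugalColourings C d S) by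
    obtain ⟨c, hc⟩ := card_pos.1 (this univ)
    exact ⟨c, mem_frugalColourings.1 hc⟩
  intro S
  induction S using Finset.induction_on with
  | empty =>
    have := Fintype.card_pos_iff.1 hC
    exact card_pos.2 ⟨fun _ => Classical.arbitrary C, mem_frugalColourings.2 (by simp)⟩
  | insert u S hu ih =>
    have := card_frugalColourings_le_two_mul hdeg hr hC S u hu
    omega

end SimpleGraph

/-! ### The number of colours needed. -/

theorem Nat.pow_self_le_three_pow_mul_factorial (d : ℕ) : d ^ d ≤ 3 ^ d * d.factorial := by
  have h1 := Real.pow_div_factorial_le_exp (x := (d : ℝ)) (by positivity) d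
  have h2 : Real.exp d ≤ 3 ^ d := by
    rw [← Real.exp_one_pow]
    exact pow_le_pow_left₀ (Real.exp_pos 1).le (by linarith [Real.exp_one_lt_d9]) d
  rw [div_le_iff₀ (by positivity)] at h1
  have h3 : (d : ℝ) ^ d ≤ 3 ^ d * d.factorial :=
    h1.trans (mul_le_mul_of_nonneg_right h2 (by positivity))
  exact_mod_cast h3

/-- The constant is `96 = 16 * 2 * 3`: `16 ^ d` absorbs `2 * Δ`, `2 ^ d` is the counting loss, and
`3 ^ d` comes from `d ! ≥ (d / 3) ^ d`. -/
theorem Nat.frugal_colour_count {Δ d r : ℕ} (hd : 2 ≤ d) (hΔ : Δ < 2 ^ (2 * d + 2))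
    (hr : 96 * Δ ≤ r * d) : 2 * (Δ * Δ.choose d) * 2 ^ d ≤ r ^ d := by
  have h1 : Δ.choose d * d.factorial ≤ Δ ^ d := by
    rw [mul_comm, ← Nat.descFactorial_eq_factorial_mul_choose]
    exact Nat.descFactorial_le_pow Δ d
  have h2 : 2 * Δ ≤ 16 ^ d := by
    have : 2 ^ (2 * d + 3) ≤ 2 ^ (4 * d) := Nat.pow_le_pow_right (by norm_num) (by omega)
    rw [pow_mul] at this
    rw [show 2 * d + 3 = 2 * d + 2 + 1 by ring, pow_succ] at this
    norm_num at this
    omega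
  have h3 := Nat.pow_le_pow_left hr d
  have h4 := Nat.pow_self_le_three_pow_mul_factorial d
  rw [mul_pow, mul_pow] at h3
  refine Nat.le_of_mul_le_mul_right ?_ (Nat.mul_pos (Nat.factorial_pos d) (pow_pos three_pos d))
  calc 2 * (Δ * Δ.choose d) * 2 ^ d * (d.factorial * 3 ^ d)
      = (2 * Δ) * (Δ.choose d * d.factorial) * (2 ^ d * 3 ^ d) := by ring
    _ ≤ 16 ^ d * Δ ^ d * (2 ^ d * 3 ^ d) := by gcongr
    _ = 96 ^ d * Δ ^ d := by
      rw [show 96 = 16 * (2 * 3) by norm_num, mul_pow, mul_pow]; ring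
    _ ≤ r ^ d * d ^ d := h3
    _ ≤ r ^ d * (3 ^ d * d.factorial) := Nat.mul_le_mul_left _ h4
    _ = _ := by ring

/-! ### The iterated logarithm. -/

namespace SepDim

theorem logStar_of_le_one {x : ℝ} (hx : x ≤ 1) : logStar x = 0 :=
  Nat.le_zero.1 (Nat.sInf_le (by simpa using hx))

theorem logStar_of_one_lt {x : ℝ} (hx : 1 < x) : logStar x = logStar (Real.logb 2 x) + 1 := by
  apply le_antisymm
  · refine Nat.sInf_le ?_
    change (Real.logb 2)^[logStar (Real.logb 2 x) + 1] x ≤ 1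
    rw [Function.iterate_succ_apply]
    exact iterate_logStar_le_one _
  · have h := iterate_logStar_le_one x
    cases hk : logStar x with
    | zero => rw [hk] at h; exact absurd h (not_le.2 hx)
    | succ k =>
      rw [hk, Function.iterate_succ_apply] at h
      exact Nat.succ_le_succ (Nat.sInf_le h)

theorem logStar_mono {x y : ℝ} (hxy : x ≤ y) : logStar x ≤ logStar y := by
  induction hk : logStar y generalizing x y with
  | zero =>
    have := iterate_logStar_le_one y
    rw [hk] at this
    exact (logStar_of_le_one (hxy.trans this)).le
  | succ k ih =>
    rcases le_or_gt x 1 with hx | hx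
    · rw [logStar_of_le_one hx]; omega
    · rw [logStar_of_one_lt (hx.trans_le hxy)] at hk
      rw [logStar_of_one_lt hx]
      exact Nat.succ_le_succ
        (ih (Real.logb_le_logb_of_le one_lt_two (by linarith) hxy) (Nat.succ.inj hk))

theorem logStar_two_pow {n : ℕ} (hn : n ≠ 0) : logStar ((2 ^ n : ℕ) : ℝ) = logStar n + 1 := by
  rw [logStar_of_one_lt (by exact_mod_cast Nat.one_lt_two_pow hn)]
  congr 2
  push_cast
  rw [Real.logb_pow, Real.logb_self_eq_one one_lt_two, mul_one]

theorem logStar_two : logStar (2 : ℕ) = 1 := by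
  simpa [logStar_of_le_one] using logStar_two_pow one_ne_zero

theorem logStar_four : logStar (4 : ℕ) = 2 := by
  have := logStar_two_pow two_ne_zero
  rwa [logStar_two] at this

theorem logStar_sixteen : logStar (16 : ℕ) = 3 := by
  have := logStar_two_pow four_ne_zero
  rwa [logStar_four] at this

end SepDim

theorem Nat.pow_four_le_two_pow {l : ℕ} (hl : 4 ≤ l) : (l + 7) ^ 4 ≤ 2 ^ (l + 17) := by
  induction l, hl using Nat.le_induction with
  | base => norm_num
  | succ l hl ih =>
    have : (l + 1 + 7) ^ 4 ≤ 2 * (l + 7) ^ 4 := by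
      obtain ⟨m, rfl⟩ := Nat.exists_eq_add_of_le hl
      ring_nf
      nlinarith [Nat.zero_le (m ^ 4), Nat.zero_le (m ^ 3), Nat.zero_le (m ^ 2), Nat.zero_le m]
    calc _ ≤ 2 * (l + 7) ^ 4 := this
      _ ≤ 2 * 2 ^ (l + 17) := Nat.mul_le_mul_left _ ih
      _ = _ := by ring

/-! ### The recursion on the maximum degree. -/

namespace SimpleGraph

variable {V : Type*} [Fintype V] {G : SimpleGraph V}

theorem card_blockSubgraph_neighbours_le {C : Type*} [AddCommGroup C] {c : V → C} {d : ℕ}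
    (hc : ∀ v i, #{u | G.Adj v u ∧ c u = i} ≤ d) (s : C) (v : V) :
    #{u | (G.blockSubgraph c s).Adj v u} ≤ 2 * d := by
  have hsub : ({u | (G.blockSubgraph c s).Adj v u} : Finset V) ⊆
      ({u | G.Adj v u ∧ c u = c v} : Finset V) ∪
        ({u | G.Adj v u ∧ c u = s - c v} : Finset V) := by
    intro u hu
    obtain ⟨h1, h2⟩ : (G.blockSubgraph c s).Adj v u := by simpa using hu
    rcases h2 with h | h
    · exact mem_union_left _ (by simp [h1, h])
    · exact mem_union_right _ (by simp [h1, ← h])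
  refine (card_le_card hsub).trans ((card_union_le _ _).trans ?_)
  have := hc v (c v)
  have := hc v (s - c v)
  omega

/-- The recursive bound: a frugal colouring reduces degree `Δ` to degree `2 * d ≤ log₂ Δ`. -/
theorem rankSeparable_of_frugal {Δ d l k : ℕ} (hd : 2 ≤ d) (hdl : 2 * d ≤ l)
    (hld : l ≤ 2 * d + 1) (hlΔ : 2 ^ l ≤ Δ) (hΔl : Δ < 2 ^ (l + 1))
    (hk : ∀ G' : SimpleGraph V, (∀ v, #{u | G'.Adj v u} ≤ 2 * d) → G'.RankSeparable (k * (2 * d)))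
    (h : ∀ v, #{u | G.Adj v u} ≤ Δ) :
    G.RankSeparable (194 * Δ * k + 512 * (l + 7) ^ 4) := by
  obtain ⟨r, hr⟩ : ∃ r, r = 96 * Δ / d + 1 := ⟨_, rfl⟩
  have : NeZero r := ⟨by rw [hr]; exact Nat.succ_ne_zero _⟩
  have hd0 : 0 < d := by omega
  have hdiv := Nat.div_mul_le_self (96 * Δ) d
  have hrd : 96 * Δ ≤ r * d := by
    have := Nat.lt_div_mul_add hd0 (a := 96 * Δ)
    rw [hr, Nat.add_mul]; omega
  have hΔd : Δ < 2 ^ (2 * d + 2) :=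
    hΔl.trans_le (Nat.pow_le_pow_right (by norm_num) (by omega))
  have hrl : r ≤ 2 ^ (l + 7) := by
    have h1 : 2 ^ (l + 7) = 2 ^ (l + 1) * 64 := by ring
    have h2 : 96 * Δ / d ≤ 96 * Δ / 2 := Nat.div_le_div_left hd (by norm_num)
    rw [h1, hr]
    exact h2.trans_lt (by omega)
  obtain ⟨c, hc⟩ := exists_frugal_colouring (C := ZMod r) (d := d) h
    (by rw [ZMod.card]; exact Nat.frugal_colour_count hd hΔd hrd) (by rw [ZMod.card]; exact NeZero.pos r)
  obtain ⟨H, hH, hsep⟩ := exists_separating_hash (r := r) (t := l + 7) (by omega) hrl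
  refine (rankSeparable_of_colouring c
    (fun s => hk _ (fun v => card_blockSubgraph_neighbours_le hc s v)) H hsep).mono ?_
  rw [ZMod.card]
  -- The rounding in `r` adds `2 * d ≤ 2 * Δ` to `192 * Δ`.
  have hle : r * (2 * d) ≤ 194 * Δ := by
    have h1 : d ≤ Δ := by
      have := Nat.lt_two_pow_self (n := l)
      omega
    rw [hr, Nat.add_mul]
    nlinarith
  have hX : Fintype.card (Fin 4 → Bool) ^ 2 * 2 = 512 := by simp
  rw [hX]
  calc r * (k * (2 * d)) + #H * 512 = r * (2 * d) * k + 512 * #H := by ring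
    _ ≤ _ := by gcongr

theorem rankSeparable_logStar (Δ : ℕ) : ∀ G : SimpleGraph V, (∀ v, #{u | G.Adj v u} ≤ Δ) →
    G.RankSeparable (2 ^ (9 * SepDim.logStar (Δ : ℝ)) * Δ) := by
  induction Δ using Nat.strong_induction_on with
  | _ Δ ih =>
  intro G h
  rcases Nat.lt_or_ge Δ 2 with h2 | h2
  · interval_cases Δ
    · exact rankSeparable_zero fun v => Nat.le_zero.1 (h v)
    · exact (rankSeparable_one h).mono (by simp [Nat.one_le_two_pow])
  rcases Nat.lt_or_ge Δ 16 with h16 | h16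
  · refine (rankSeparable_of_sq_colouring h).mono ?_
    rcases Nat.lt_or_ge Δ 4 with h4 | h4
    · have hL : 1 ≤ SepDim.logStar (Δ : ℝ) := by
        rw [← SepDim.logStar_two]; exact SepDim.logStar_mono (by exact_mod_cast h2)
      have : 2 ^ 9 ≤ 2 ^ (9 * SepDim.logStar (Δ : ℝ)) :=
        Nat.pow_le_pow_right (by norm_num) (by omega)
      refine le_trans ?_ (Nat.mul_le_mul_right _ this)
      interval_cases Δ <;> norm_num
    · have hL : 2 ≤ SepDim.logStar (Δ : ℝ) := by
        rw [← SepDim.logStar_four]; exact SepDim.logStar_mono (by exact_mod_cast h4)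
      have : 2 ^ 18 ≤ 2 ^ (9 * SepDim.logStar (Δ : ℝ)) :=
        Nat.pow_le_pow_right (by norm_num) (by omega)
      refine le_trans ?_ (Nat.mul_le_mul_right _ this)
      interval_cases Δ <;> norm_num
  set l := Nat.log 2 Δ with hl
  have hlΔ : 2 ^ l ≤ Δ := Nat.pow_log_le_self 2 (by omega)
  have hΔl : Δ < 2 ^ (l + 1) := Nat.lt_pow_succ_log_self one_lt_two Δ
  have hl4 : 4 ≤ l := Nat.le_log_of_pow_le one_lt_two (by simpa using h16)
  have hlt : 2 * (l / 2) < Δ := by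
    have := Nat.lt_two_pow_self (n := l)
    omega
  have key := rankSeparable_of_frugal (d := l / 2) (by omega) (by omega) (by omega) hlΔ hΔl
    (ih _ hlt) h
  refine key.mono ?_
  -- This follows from `2 ^ (2 * (l / 2)) ≤ 2 ^ l ≤ Δ`.
  have hL : SepDim.logStar ((2 * (l / 2) : ℕ) : ℝ) + 1 ≤ SepDim.logStar (Δ : ℝ) := by
    rw [← SepDim.logStar_two_pow (by omega)]
    refine SepDim.logStar_mono ?_
    exact_mod_cast (Nat.pow_le_pow_right two_pos (by omega)).trans hlΔ
  have hL3 : 3 ≤ SepDim.logStar (Δ : ℝ) := by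
    rw [← SepDim.logStar_sixteen]; exact SepDim.logStar_mono (by exact_mod_cast h16)
  obtain ⟨L, hLe⟩ := Nat.exists_eq_add_of_le hL3
  rw [hLe] at hL ⊢
  set K := 2 ^ (9 * (L + 2)) with hK
  have hk1 : 2 ^ (9 * SepDim.logStar ((2 * (l / 2) : ℕ) : ℝ)) ≤ K :=
    Nat.pow_le_pow_right two_pos (by omega)
  have hk2 : 2 ^ 18 ≤ K := Nat.pow_le_pow_right two_pos (by omega)
  have hk3 : 2 ^ (9 * (3 + L)) = 512 * K := by
    rw [hK, show 9 * (3 + L) = 9 * (L + 2) + 9 by ring, pow_add]; norm_num [mul_comm]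
  -- The hashing cost takes 256 of the factor 512; the recursion takes 194.
  have h4 : 512 * (l + 7) ^ 4 ≤ 256 * Δ * K := by
    calc 512 * (l + 7) ^ 4 ≤ 512 * 2 ^ (l + 17) :=
          Nat.mul_le_mul_left _ (Nat.pow_four_le_two_pow hl4)
      _ = 256 * 2 ^ l * 2 ^ 18 := by ring
      _ ≤ _ := by gcongr
  rw [hk3]
  calc _ ≤ 194 * Δ * K + 256 * Δ * K := by gcongr
    _ ≤ _ := by nlinarith [Nat.zero_le (Δ * K)]

end SimpleGraph

end

theorem mainTheorem2 {V : Type*} [Fintype V] (G : SimpleGraph V) [DecidableRel G.Adj] :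
    SepDim.separationDimension (SepDim.graphHypergraph G) ≤
      2 ^ (9 * SepDim.logStar (G.maxDegree : ℝ)) * G.maxDegree := by
  refine (SimpleGraph.rankSeparable_logStar G.maxDegree G fun v => ?_).separationDimension_le
  convert G.degree_le_maxDegree v using 1
  rw [← G.card_neighborFinset_eq_degree, G.neighborFinset_eq_filter]
  congr
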